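/- **Proposition.** There is a universal constant $C>0$ such that the following holds for all integers $n\ge 2$ and $m\ge 0$. For $\ell=1,\dots,m$ let $v_\ell\in\mathbb{R}^n$ with $\|v_\ell\|_2=1$, let $t_\ell\in\mathbb{R}$, and let $H_\ell=\{x\in\mathbb{R}^n:\langle v_\ell,x\rangle=t_\ell\}$. For $v\in\mathbb{R}^n$ and $j\in\mathbb{Z}$ let $K_v(j)=\{k\in[n]: 2^{-j-1}<|v_k|\le 2^{-j}\}$, and let $v^{(j)}\in\mathbb{R}^n$ be the vector that agrees with $v$ on the coordinates in $K_v(j)$ and is $0$ elsewhere. Let $J_\ell$ be the finite set of integers $j$ with $K_{v_\ell}(j)\neq\emptyset$. Let $\alpha_{\ell j}$ ($1\le \ell\le m$, $j\in J_\ell$) be independent random variables, each uniform in $[-1,1]$, and let $P$ be the random vector $$\frac{1}{10\sqrt{m\log n}}\sum_{\ell=1}^m\sum_{j\in J_\ell}\alpha_{\ell j}\,2^{j}\,v_\ell^{(j)}$$ (the zero vector if $m=0$), conditioned on the event $\|P\|_\infty\le 1/2$. Here $\log$ is the natural logarithm. For $p\in[-1,1]^n$ let $\mu_p$ be the distribution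 on $\{-1,1\}^n$ with independent coordinates $z_i$ satisfying $\Pr[z_i=1]=\frac{1+p_i}{2}$ and $\Pr[z_i=-1]=\frac{1-p_i}{2}$. Given $P$, draw $U\sim\mu_P$; independently of $(P,U)$ let $k$ be uniform in $[n]$. Let $(U,k)$ denote the edge of the cube graph on $\{-1,1\}^n$ that is incident to $U$ and parallel to the $k$-th axis. An edge crosses a hyperplane if, as a closed segment, it meets the hyperplane and neither of its endpoints lies on it. Then the distribution of $(U,k)$ is well defined (the conditioning event has positive probability), and for every $\ell\in\{1,\dots,m\}$, $$\Pr\big[(U,k)\text{ crosses }H_\ell\big]\le C\,\frac{\sqrt m\,\log(n)^2}{n}.$$ -/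

import Mathlib

open MeasureTheory ProbabilityTheory

noncomputable section

namespace CubeSlicing

/-! ### The cube, its edges and hyperplanes -/

/-- Vertices of the cube `{-1, 1}ⁿ`; the two-element type `ℤˣ = {1, -1}` is the type of signs. -/
abbrev Vertex (n : ℕ) : Type := Fin n → ℤˣ

instance instDiscreteMeasurableSpaceSign : DiscreteMeasurableSpace ℤˣ :=
  ⟨fun s => ⟨Units.val '' s, trivial, Set.preimage_image_eq s Units.val_injective⟩⟩

/-- A vertex as a point of `ℝⁿ`. -/
def Vertex.toPoint {n : ℕ} (u : Vertex n) : EuclideanSpace ℝ (Fin n) :=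
  WithLp.toLp 2 fun i => ((u i : ℤ) : ℝ)

/-- The other endpoint of the edge which is incident to `u` and parallel to the `k`-th axis. -/
def Vertex.flip {n : ℕ} (u : Vertex n) (k : Fin n) : Vertex n :=
  Function.update u k (-u k)

/-- The hyperplane `{x : ⟨v, x⟩ = t}`. -/
def hyperplane {n : ℕ} (v : EuclideanSpace ℝ (Fin n)) (t : ℝ) : Set (EuclideanSpace ℝ (Fin n)) :=
  {x | inner ℝ v x = t}

/-- The edge `(u, k)` crosses the set `H`: the closed segment meets `H`, but neither endpoint
lies in `H`. -/
def Crosses {n : ℕ} (u : Vertex n) (k : Fin n) (H : Set (EuclideanSpace ℝ (Fin n))) : Prop :=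
  (segment ℝ u.toPoint (u.flip k).toPoint ∩ H).Nonempty ∧
    u.toPoint ∉ H ∧ (u.flip k).toPoint ∉ H

/-! ### Binary decomposition of a vector -/

/-- `K(j)`: the coordinates of `v` of absolute value in `(2^(-j-1), 2^(-j)]`. -/
def binGroup {n : ℕ} (v : EuclideanSpace ℝ (Fin n)) (j : ℤ) : Set (Fin n) :=
  {k | (2 : ℝ) ^ (-j - 1) < |v k| ∧ |v k| ≤ (2 : ℝ) ^ (-j)}

theorem finite_setOf_binGroup_nonempty {n : ℕ} (v : EuclideanSpace ℝ (Fin n)) :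
    {j : ℤ | (binGroup v j).Nonempty}.Finite := by
  refine (Set.finite_range fun k : Fin n => -Int.clog 2 |v k|).subset ?_
  rintro j ⟨k, hk1, hk2⟩
  refine ⟨k, ?_⟩
  have hpos : 0 < |v k| := lt_trans (by positivity) hk1
  have h1 : Int.clog 2 |v k| ≤ -j :=
    (Int.le_zpow_iff_clog_le (by norm_num) hpos).1 (by exact_mod_cast hk2)
  have h2 : -j - 1 < Int.clog 2 |v k| :=
    (Int.zpow_lt_iff_lt_clog (by norm_num) hpos).1 (by exact_mod_cast hk1)
  show -Int.clog 2 |v k| = j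
  omega

/-- `J`: the (finitely many) integers `j` for which `K(j)` is nonempty. -/
def binIndices {n : ℕ} (v : EuclideanSpace ℝ (Fin n)) : Finset ℤ :=
  (finite_setOf_binGroup_nonempty v).toFinset

/-- `v^(j)`: the vector which agrees with `v` on `K(j)` and vanishes elsewhere. -/
def binPart {n : ℕ} (v : EuclideanSpace ℝ (Fin n)) (j : ℤ) : Fin n → ℝ :=
  (binGroup v j).indicator fun k => v k

/-! ### The random bias -/

/-- Index set of the coefficients `α_{ℓ j}`, with `ℓ < m` and `j ∈ J_ℓ`. -/
abbrev CoeffIndex {n m : ℕ} (v : Fin m → EuclideanSpace ℝ (Fin n)) : Type :=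
  Σ ℓ : Fin m, ↥(binIndices (v ℓ))

/-- The coefficients `α_{ℓ j}` are independent and uniform in `[-1, 1]`. -/
def coeffLaw {n m : ℕ} (v : Fin m → EuclideanSpace ℝ (Fin n)) : Measure (CoeffIndex v → ℝ) :=
  Measure.pi fun _ => (volume : Measure ℝ)[|Set.Icc (-1) 1]

/-- `P = (10 √(m log n))⁻¹ ∑_ℓ ∑_{j ∈ J_ℓ} α_{ℓ j} 2^j v_ℓ^(j)`, as a function of the
coefficients. Its values are in `Fin n → ℝ`, the norm of which is the maximum norm. -/
def randomBias {n m : ℕ} (v : Fin m → EuclideanSpace ℝ (Fin n)) (α : CoeffIndex v → ℝ) :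
    Fin n → ℝ :=
  (1 / (10 * Real.sqrt (m * Real.log n))) •
    ∑ ℓ : Fin m, ∑ j : ↥(binIndices (v ℓ)),
      (α ⟨ℓ, j⟩ * (2 : ℝ) ^ (j : ℤ)) • binPart (v ℓ) j

/-- The law of `P` conditioned on `‖P‖_∞ ≤ 1/2`. -/
def biasLaw {n m : ℕ} (v : Fin m → EuclideanSpace ℝ (Fin n)) : Measure (Fin n → ℝ) :=
  ((coeffLaw v).map (randomBias v))[|{p | ‖p‖ ≤ 1 / 2}]

/-! ### The random edge -/

/-- The law on `{1, -1}` giving mass `(1 + q) / 2` to `1` and `(1 - q) / 2` to `-1`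
(for `-1 ≤ q ≤ 1`). -/
def signLaw (q : ℝ) : Measure ℤˣ :=
  ENNReal.ofReal ((1 + q) / 2) • Measure.dirac 1 +
    ENNReal.ofReal ((1 - q) / 2) • Measure.dirac (-1)

instance instIsFiniteMeasureSignLaw (q : ℝ) : IsFiniteMeasure (signLaw q) := by
  constructor
  simp [signLaw]

/-- The product measure `μ_p` on the vertices of the cube (for `p ∈ [-1, 1]ⁿ`). -/
def vertexLaw {n : ℕ} (p : Fin n → ℝ) : Measure (Vertex n) :=
  Measure.pi fun i => signLaw (p i)

theorem measurable_vertexLaw (n : ℕ) :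
    Measurable (vertexLaw : (Fin n → ℝ) → Measure (Vertex n)) := by
  refine Measure.measurable_of_measurable_coe _ fun s _ => ?_
  have h : ∀ p : Fin n → ℝ, vertexLaw p s =
      ∑ z ∈ s.toFinite.toFinset, ∏ i, signLaw (p i) {z i} := by
    intro p
    have h2 : (s.toFinite.toFinset : Set (Vertex n)) = s := by simp
    conv_lhs => rw [← h2]
    rw [← sum_measure_singleton]
    refine Finset.sum_congr rfl fun z _ => ?_
    rw [vertexLaw, Measure.pi_singleton]
  simp_rw [h]
  refine Finset.measurable_sum _ fun z _ => Finset.measurable_prod _ fun i _ => ?_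
  simp only [signLaw, Measure.coe_add, Measure.coe_smul, Pi.add_apply, Pi.smul_apply, smul_eq_mul]
  fun_prop

/-- The Markov kernel `p ↦ μ_p`. -/
def vertexKernel (n : ℕ) : Kernel (Fin n → ℝ) (Vertex n) where
  toFun := vertexLaw
  measurable' := measurable_vertexLaw n

/-- The law of the random edge `(U, k)`: `U` is drawn from `μ_P`, where `P` is drawn from
`biasLaw v`, and `k` is an independent uniform coordinate. -/
def edgeLaw {n m : ℕ} (v : Fin m → EuclideanSpace ℝ (Fin n)) : Measure (Vertex n × Fin n) :=
  ((biasLaw v).bind (vertexKernel n)).prod (uniformOn Set.univ)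

end CubeSlicing

end

noncomputable section

namespace CubeSlicing

variable {n : ℕ}

/-! ### Crossing edges -/

/-! Fix a hyperplane with normal `v = v_ℓ` and let `f` be the indicator of the half-space `t < ⟨v,
x⟩`. In direction `k` the function `f` is monotone with orientation `sign v_k`. Hence nothing
cancels in the Margulis–Russo formula for the derivative of `E f` along a bias direction with the
signs of `v`: every crossing edge contributes positively. Freeze all coefficients but `α_{ℓj}`. The
bias then moves along a line whose direction vanishes off bin `j` and, thanks to the factor `2^j`,
has entries of size at least `biasScale / 2` on it. As `E f` stays in `[0, 1]`, the expected number
of crossing edges in the directions of bin `j` is at most `8 / biasScale = 80 √(m log n)`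
(`sum_setLIntegral_vertexLaw_crossSet_le`).

There may be up to `n` bins, too many to sum this over. Bins preceded by many coarser ones are
handled by a Littlewood–Offord argument. A crossing edge confines `⟨v, u⟩` to a window of width of
order `2^(-j)`, while `R` coarser coordinates on scales a factor 8 apart have well-separated signed
sums. Each sign has mass at most `3/4` when `‖p‖ ≤ 1/2`, so a crossing has probability at most
`(3/4)^R` (`sum_vertexWeight_crossSet_le`). At most `3R` bins are not of this kind.

Taking `R` about `4 log n` gives `O(log n · √(m log n))` expected crossings in all directions
together; the uniform choice of `k` divides by `n`. Conditioning on `‖P‖ ≤ 1/2` costs a factor 2, by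
a sub-Gaussian tail bound and a union bound (`half_le_coeffLaw_norm_randomBias_le`). -/

theorem inner_toPoint (v : EuclideanSpace ℝ (Fin n)) (u : Vertex n) :
    inner ℝ v u.toPoint = ∑ i, ((u i : ℤ) : ℝ) * v i := by
  simp [PiLp.inner_apply, Vertex.toPoint]

theorem inner_toPoint_flip (v : EuclideanSpace ℝ (Fin n)) (u : Vertex n) (k : Fin n) :
    inner ℝ v (u.flip k).toPoint = inner ℝ v u.toPoint - 2 * (((u k : ℤ) : ℝ) * v k) := by
  have h : ∑ i, (((u i : ℤ) : ℝ) * v i - (((u.flip k) i : ℤ) : ℝ) * v i) =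
      2 * (((u k : ℤ) : ℝ) * v k) := by
    rw [Finset.sum_eq_single k]
    · simp [Vertex.flip]; ring
    · intro i _ hi
      simp [Vertex.flip, Function.update_of_ne hi]
    · simp
  rw [Finset.sum_sub_distrib] at h
  rw [inner_toPoint, inner_toPoint]
  linarith

theorem abs_sign (s : ℤˣ) : |((s : ℤ) : ℝ)| = 1 := by
  rcases Int.units_eq_one_or s with rfl | rfl <;> simp

theorem Crosses.mul_neg {u : Vertex n} {k : Fin n} {v : EuclideanSpace ℝ (Fin n)} {t : ℝ}
    (h : Crosses u k (hyperplane v t)) :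
    (inner ℝ v u.toPoint - t) * (inner ℝ v (u.flip k).toPoint - t) < 0 := by
  obtain ⟨⟨x, hx, hxt⟩, h1, h2⟩ := h
  rw [segment_eq_image] at hx
  obtain ⟨θ, ⟨h0, hθ⟩, rfl⟩ := hx
  simp only [hyperplane, Set.mem_ofPred_eq] at hxt h1 h2
  rw [inner_add_right, inner_smul_right, inner_smul_right] at hxt
  set a := inner ℝ v u.toPoint
  set b := inner ℝ v (u.flip k).toPoint
  have ha : a - t ≠ 0 := sub_ne_zero.2 h1
  have hb : b - t ≠ 0 := sub_ne_zero.2 h2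
  have e : (1 - θ) * (a - t) + θ * (b - t) = 0 := by linear_combination hxt
  by_contra hc
  have hc' : 0 < (a - t) * (b - t) := lt_of_le_of_ne (not_lt.1 hc) (mul_ne_zero ha hb).symm
  have hsq : 0 < (a - t) ^ 2 := by positivity
  have e2 : (1 - θ) * (a - t) ^ 2 + θ * ((a - t) * (b - t)) = 0 := by
    linear_combination (a - t) * e
  rcases h0.eq_or_lt with rfl | h0
  · simp at e2; exact ha e2
  · have : 0 < θ * ((a - t) * (b - t)) := by positivity
    have : 0 ≤ (1 - θ) * (a - t) ^ 2 := mul_nonneg (by linarith) hsq.le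
    linarith

/-- The endpoints lie strictly on opposite sides, and their inner products with `v` differ by
exactly `2 * |v k|`. -/
theorem Crosses.abs_sub_lt {u : Vertex n} {k : Fin n} {v : EuclideanSpace ℝ (Fin n)} {t : ℝ}
    (h : Crosses u k (hyperplane v t)) : |inner ℝ v u.toPoint - t| < 2 * |v k| := by
  have h1 := h.mul_neg
  rw [inner_toPoint_flip] at h1
  have h3 : |2 * (((u k : ℤ) : ℝ) * v k)| = 2 * |v k| := by
    rw [abs_mul, abs_mul, abs_sign]; simp
  rw [← h3]
  set a := inner ℝ v u.toPoint - t with ha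
  set d := 2 * (((u k : ℤ) : ℝ) * v k)
  have h2 : a * (a - d) < 0 := by convert h1 using 2; rw [ha]; ring
  rcases mul_neg_iff.1 h2 with ⟨p, q⟩ | ⟨p, q⟩
  · rw [abs_of_pos p, abs_of_pos (by linarith)]; linarith
  · rw [abs_of_neg p, abs_of_neg (by linarith)]; linarith

theorem Crosses.ne_zero {u : Vertex n} {k : Fin n} {v : EuclideanSpace ℝ (Fin n)} {t : ℝ}
    (h : Crosses u k (hyperplane v t)) : v k ≠ 0 := by
  intro h0
  have := h.abs_sub_lt
  rw [h0] at this
  simp only [abs_zero, mul_zero] at this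
  exact absurd this (abs_nonneg _).not_gt

open Classical in
/-- The indicator of the open half-space `{x : t < ⟨v, x⟩}` on the vertices of the cube. -/
def halfSpace (v : EuclideanSpace ℝ (Fin n)) (t : ℝ) (u : Vertex n) : ℝ :=
  if t < inner ℝ v u.toPoint then 1 else 0

theorem halfSpace_nonneg (v : EuclideanSpace ℝ (Fin n)) (t : ℝ) (u : Vertex n) :
    0 ≤ halfSpace v t u := by
  unfold halfSpace; split_ifs <;> norm_num

theorem halfSpace_le_one (v : EuclideanSpace ℝ (Fin n)) (t : ℝ) (u : Vertex n) :
    halfSpace v t u ≤ 1 := by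
  unfold halfSpace; split_ifs <;> norm_num

/-- Monotonicity of the half-space: moving coordinate `k` towards the sign of `v k` can only enter
it. This is what rules out cancellation in the derivative formula. -/
theorem mul_halfSpace_sub_flip_nonneg (v : EuclideanSpace ℝ (Fin n)) (t : ℝ) (u : Vertex n)
    (k : Fin n) :
    0 ≤ v k * (((u k : ℤ) : ℝ) * (halfSpace v t u - halfSpace v t (u.flip k))) := by
  unfold halfSpace
  rw [inner_toPoint_flip]
  split_ifs with h1 h2 h2
  · simp
  · nlinarith
  · nlinarith
  · simp

theorem Crosses.abs_le_mul_halfSpace_sub_flip {u : Vertex n} {k : Fin n}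
    {v : EuclideanSpace ℝ (Fin n)} {t : ℝ} (h : Crosses u k (hyperplane v t)) :
    |v k| ≤ v k * (((u k : ℤ) : ℝ) * (halfSpace v t u - halfSpace v t (u.flip k))) := by
  have h0 := mul_halfSpace_sub_flip_nonneg v t u k
  have h1 := h.mul_neg
  have h2 : |halfSpace v t u - halfSpace v t (u.flip k)| = 1 := by
    unfold halfSpace
    rcases mul_neg_iff.1 h1 with ⟨p, q⟩ | ⟨p, q⟩
    · rw [if_pos (by linarith), if_neg (by linarith)]; norm_num
    · rw [if_neg (by linarith), if_pos (by linarith)]; norm_num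
  rw [← abs_of_nonneg h0, abs_mul, abs_mul, h2, abs_sign]
  simp

theorem flip_flip (u : Vertex n) (k : Fin n) : (u.flip k).flip k = u := by
  ext i
  by_cases h : i = k
  · subst h; simp [Vertex.flip]
  · simp [Vertex.flip, h]

/-- Flipping a coordinate, as a permutation of the vertices. -/
def flipEquiv (k : Fin n) : Vertex n ≃ Vertex n where
  toFun u := u.flip k
  invFun u := u.flip k
  left_inv u := flip_flip u k
  right_inv u := flip_flip u k

/-! ### Product measures on the cube -/

/-- The mass of a sign under `signLaw q`, as a real number. -/
def signWeight (q : ℝ) (s : ℤˣ) : ℝ := (1 + ((s : ℤ) : ℝ) * q) / 2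

theorem signWeight_nonneg {q : ℝ} (hq : |q| ≤ 1) (s : ℤˣ) : 0 ≤ signWeight q s := by
  have := abs_le.1 hq
  rcases Int.units_eq_one_or s with rfl | rfl <;> simp [signWeight] <;> linarith

theorem signWeight_le {q : ℝ} (hq : |q| ≤ 1 / 2) (s : ℤˣ) : signWeight q s ≤ 3 / 4 := by
  have := abs_le.1 hq
  rcases Int.units_eq_one_or s with rfl | rfl <;> simp [signWeight] <;> linarith

theorem signWeight_le_one {q : ℝ} (hq : |q| ≤ 1) (s : ℤˣ) : signWeight q s ≤ 1 := by
  have := abs_le.1 hq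
  rcases Int.units_eq_one_or s with rfl | rfl <;> simp [signWeight] <;> linarith

theorem sum_signWeight (q : ℝ) : ∑ s, signWeight q s = 1 := by
  have : (Finset.univ : Finset ℤˣ) = {1, -1} := rfl
  rw [this, Finset.sum_pair (by decide)]
  simp [signWeight]; ring

theorem signLaw_singleton (q : ℝ) (s : ℤˣ) :
    signLaw q {s} = ENNReal.ofReal (signWeight q s) := by
  rcases Int.units_eq_one_or s with rfl | rfl
  · have : (-1 : ℤˣ) ∉ ({1} : Set ℤˣ) := by decide
    simp [signLaw, signWeight]
  · have : (1 : ℤˣ) ∉ ({-1} : Set ℤˣ) := by decide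
    simp [signLaw, signWeight, sub_eq_add_neg]

/-- The mass of a vertex under `vertexLaw p`, as a real number. -/
def vertexWeight (p : Fin n → ℝ) (u : Vertex n) : ℝ := ∏ i, signWeight (p i) (u i)

theorem vertexWeight_nonneg {p : Fin n → ℝ} (hp : ‖p‖ ≤ 1) (u : Vertex n) :
    0 ≤ vertexWeight p u :=
  Finset.prod_nonneg fun i _ => signWeight_nonneg ((norm_le_pi_norm p i).trans hp) _

theorem sum_vertexWeight (p : Fin n → ℝ) : ∑ u, vertexWeight p u = 1 := by
  have := Finset.prod_univ_sum (fun _ : Fin n => (Finset.univ : Finset ℤˣ))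
    (fun i s => signWeight (p i) s)
  simp only [sum_signWeight, Finset.prod_const_one, Fintype.piFinset_univ] at this
  exact this.symm

theorem vertexLaw_apply {p : Fin n → ℝ} (hp : ‖p‖ ≤ 1) (A : Finset (Vertex n)) :
    vertexLaw p (A : Set (Vertex n)) = ENNReal.ofReal (∑ u ∈ A, vertexWeight p u) := by
  rw [← sum_measure_singleton, ENNReal.ofReal_sum_of_nonneg fun u _ => vertexWeight_nonneg hp u]
  refine Finset.sum_congr rfl fun u _ => ?_
  rw [vertexLaw, Measure.pi_singleton, vertexWeight, ENNReal.ofReal_prod_of_nonneg]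
  · simp only [signLaw_singleton]
  · exact fun i _ => signWeight_nonneg ((norm_le_pi_norm p i).trans hp) _

theorem isProbabilityMeasure_vertexLaw {p : Fin n → ℝ} (hp : ‖p‖ ≤ 1) :
    IsProbabilityMeasure (vertexLaw p) := by
  constructor
  have := vertexLaw_apply hp Finset.univ
  rwa [sum_vertexWeight, Finset.coe_univ, ENNReal.ofReal_one] at this

/-- If the vertices of `A` are determined by their coordinates outside `I`, then `A` has
small measure. -/
theorem sum_vertexWeight_le_pow {p : Fin n → ℝ} (hp : ‖p‖ ≤ 1 / 2) (A : Finset (Vertex n))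
    (I : Finset (Fin n))
    (hA : ∀ u ∈ A, ∀ u' ∈ A, (∀ i ∉ I, u i = u' i) → u = u') :
    ∑ u ∈ A, vertexWeight p u ≤ (3 / 4) ^ I.card := by
  classical
  have hp' : ∀ i, |p i| ≤ 1 / 2 := fun i => (norm_le_pi_norm p i).trans hp
  have hp1 : ∀ i, |p i| ≤ 1 := fun i => (hp' i).trans (by norm_num)
  -- `φ` erases the coordinates in `I` and is injective on `A`. Bounding each factor in `I` by `3/4`
  -- leaves a sum over distinct vertices pinned to `1` on `I`, whose total mass is at most 1.
  let φ : Vertex n → Vertex n := fun u i => if i ∈ I then 1 else u i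
  let g : Fin n → ℤˣ → ℝ := fun i s => if i ∈ I then 1 else signWeight (p i) s
  have hg : ∀ i s, 0 ≤ g i s := fun i s => by
    simp only [g]; split_ifs
    · norm_num
    · exact signWeight_nonneg (hp1 i) s
  have h1 : ∀ u, vertexWeight p u ≤ (3 / 4) ^ I.card * ∏ i, g i (φ u i) := by
    intro u
    have : ((3 / 4 : ℝ)) ^ I.card = ∏ i, if i ∈ I then (3 / 4 : ℝ) else 1 := by
      rw [Finset.prod_ite_mem, Finset.univ_inter, Finset.prod_const]
    rw [this, ← Finset.prod_mul_distrib]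
    refine Finset.prod_le_prod (fun i _ => signWeight_nonneg (hp1 i) _) fun i _ => ?_
    by_cases hi : i ∈ I
    · simpa [g, hi] using signWeight_le (hp' i) (u i)
    · simp [g, φ, hi]
  have hinj : Set.InjOn φ A := by
    intro u hu u' hu' h
    refine hA u hu u' hu' fun i hi => ?_
    simpa [φ, hi] using congrFun h i
  have h2 : ∑ u ∈ A, ∏ i, g i (φ u i) ≤ 1 := by
    rw [← Finset.sum_image (f := fun y : Vertex n => ∏ i, g i (y i)) hinj]
    have h3 := Finset.prod_univ_sum
      (fun i : Fin n => if i ∈ I then ({1} : Finset ℤˣ) else Finset.univ) g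
    have h4 : ∏ i, ∑ s ∈ (if i ∈ I then ({1} : Finset ℤˣ) else Finset.univ), g i s = 1 := by
      refine Finset.prod_eq_one fun i _ => ?_
      by_cases hi : i ∈ I
      · simp [g, hi]
      · simp only [g, hi, if_false, sum_signWeight]
    rw [← h4, h3]
    refine Finset.sum_le_sum_of_subset_of_nonneg ?_ fun y _ _ =>
      Finset.prod_nonneg fun i _ => hg i _
    intro y hy
    obtain ⟨u, -, rfl⟩ := Finset.mem_image.1 hy
    rw [Fintype.mem_piFinset]
    intro i
    by_cases hi : i ∈ I
    · simp [φ, hi]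
    · simp only [φ, hi, if_false, Finset.mem_univ]
  calc ∑ u ∈ A, vertexWeight p u ≤ ∑ u ∈ A, (3 / 4) ^ I.card * ∏ i, g i (φ u i) :=
        Finset.sum_le_sum fun u _ => h1 u
    _ = (3 / 4) ^ I.card * ∑ u ∈ A, ∏ i, g i (φ u i) := by rw [Finset.mul_sum]
    _ ≤ (3 / 4) ^ I.card * 1 := by gcongr
    _ = _ := mul_one _

/-! ### The derivative of a half-space probability along the bias -/

/-- The mass of the coordinates of `u` other than `k`. -/
def edgeWeight (p : Fin n → ℝ) (k : Fin n) (u : Vertex n) : ℝ :=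
  ∏ i ∈ Finset.univ.erase k, signWeight (p i) (u i)

theorem edgeWeight_nonneg {p : Fin n → ℝ} (hp : ‖p‖ ≤ 1) (k : Fin n) (u : Vertex n) :
    0 ≤ edgeWeight p k u :=
  Finset.prod_nonneg fun i _ => signWeight_nonneg ((norm_le_pi_norm p i).trans hp) _

theorem vertexWeight_le_edgeWeight {p : Fin n → ℝ} (hp : ‖p‖ ≤ 1) (k : Fin n) (u : Vertex n) :
    vertexWeight p u ≤ edgeWeight p k u := by
  rw [vertexWeight, ← Finset.mul_prod_erase _ _ (Finset.mem_univ k)]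
  exact mul_le_of_le_one_left (edgeWeight_nonneg hp k u)
    (signWeight_le_one ((norm_le_pi_norm p k).trans hp) _)

theorem edgeWeight_flip (p : Fin n → ℝ) (k : Fin n) (u : Vertex n) :
    edgeWeight p k (u.flip k) = edgeWeight p k u := by
  refine Finset.prod_congr rfl fun i hi => ?_
  rw [Vertex.flip, Function.update_of_ne (Finset.ne_of_mem_erase hi)]

/-- Add the sum to its reindexing by the flip, which negates `u k` and preserves `edgeWeight`. -/
theorem two_mul_sum_sign_mul_edgeWeight (p : Fin n → ℝ) (k : Fin n) (f : Vertex n → ℝ) :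
    2 * ∑ u, ((u k : ℤ) : ℝ) * edgeWeight p k u * f u =
      ∑ u, edgeWeight p k u * (((u k : ℤ) : ℝ) * (f u - f (u.flip k))) := by
  have h := Equiv.sum_comp (flipEquiv k) fun u => ((u k : ℤ) : ℝ) * edgeWeight p k u * f u
  rw [two_mul]
  nth_rewrite 2 [← h]
  rw [← Finset.sum_add_distrib]
  refine Finset.sum_congr rfl fun u _ => ?_
  have e : flipEquiv k u = u.flip k := rfl
  rw [e, edgeWeight_flip]
  simp [Vertex.flip]
  ring

open Classical in
/-- The edges parallel to the `k`-th axis which cross the hyperplane, by their endpoints. -/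
def crossSet (v : EuclideanSpace ℝ (Fin n)) (t : ℝ) (k : Fin n) : Finset (Vertex n) :=
  {u | Crosses u k (hyperplane v t)}

theorem coe_crossSet (v : EuclideanSpace ℝ (Fin n)) (t : ℝ) (k : Fin n) :
    (crossSet v t k : Set (Vertex n)) = {u | Crosses u k (hyperplane v t)} := by
  ext; simp [crossSet]

theorem mem_crossSet {v : EuclideanSpace ℝ (Fin n)} {t : ℝ} {k : Fin n} {u : Vertex n} :
    u ∈ crossSet v t k ↔ Crosses u k (hyperplane v t) := by
  simp [crossSet]

theorem abs_mul_sum_crossSet_le {p : Fin n → ℝ} (hp : ‖p‖ ≤ 1)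
    (v : EuclideanSpace ℝ (Fin n)) (t : ℝ) (k : Fin n) :
    |v k| * ∑ u ∈ crossSet v t k, vertexWeight p u ≤
      2 * (v k * ∑ u, ((u k : ℤ) : ℝ) * edgeWeight p k u * halfSpace v t u) := by
  rw [mul_left_comm, two_mul_sum_sign_mul_edgeWeight, Finset.mul_sum, Finset.mul_sum]
  calc ∑ u ∈ crossSet v t k, |v k| * vertexWeight p u
      ≤ ∑ u ∈ crossSet v t k, v k * (edgeWeight p k u *
          (((u k : ℤ) : ℝ) * (halfSpace v t u - halfSpace v t (u.flip k)))) := by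
        refine Finset.sum_le_sum fun u hu => ?_
        have h1 := (mem_crossSet.1 hu).abs_le_mul_halfSpace_sub_flip
        calc |v k| * vertexWeight p u ≤ |v k| * edgeWeight p k u := by
              gcongr; exact vertexWeight_le_edgeWeight hp k u
          _ ≤ _ := mul_le_mul_of_nonneg_right h1 (edgeWeight_nonneg hp k u)
          _ = _ := by ring
    _ ≤ _ := by
        refine Finset.sum_le_sum_of_subset_of_nonneg (Finset.subset_univ _) fun u _ _ => ?_
        have := mul_nonneg (edgeWeight_nonneg hp k u) (mul_halfSpace_sub_flip_nonneg v t u k)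
        linarith

/-- The Margulis–Russo formula: each weight is a product of factors affine in the bias, so the
product rule applies. -/
theorem hasDerivAt_sum_vertexWeight (b w : Fin n → ℝ) (f : Vertex n → ℝ) (a : ℝ) :
    HasDerivAt (fun a : ℝ => ∑ u, vertexWeight (b + a • w) u * f u)
      (∑ k, w k / 2 * ∑ u, ((u k : ℤ) : ℝ) * edgeWeight (b + a • w) k u * f u) a := by
  have h : ∀ (u : Vertex n) (i : Fin n),
      HasDerivAt (fun a : ℝ => signWeight ((b + a • w) i) (u i))
        (((u i : ℤ) : ℝ) * w i / 2) a := by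
    intro u i
    have := (((hasDerivAt_mul_const (x := a) (w i)).const_add (b i)).const_mul
      ((u i : ℤ) : ℝ)).const_add 1 |>.div_const 2
    simpa [signWeight] using this
  have h2 : ∀ u, HasDerivAt (fun a : ℝ => vertexWeight (b + a • w) u * f u)
      ((∑ k, edgeWeight (b + a • w) k u • (((u k : ℤ) : ℝ) * w k / 2)) * f u) a := fun u =>
    (HasDerivAt.fun_finsetProd fun i _ => h u i).mul_const (f u)
  have h3 := HasDerivAt.fun_sum fun u (_ : u ∈ Finset.univ) => h2 u
  refine h3.congr_deriv ?_
  simp only [Finset.mul_sum, Finset.sum_mul, smul_eq_mul]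
  rw [Finset.sum_comm]
  refine Finset.sum_congr rfl fun u _ => Finset.sum_congr rfl fun k _ => ?_
  ring

theorem continuous_signWeight (s : ℤˣ) : Continuous fun q => signWeight q s := by
  unfold signWeight; fun_prop

theorem continuous_vertexWeight (u : Vertex n) : Continuous fun p => vertexWeight p u :=
  continuous_finsetProd _ fun i _ => (continuous_signWeight (u i)).comp (continuous_apply i)

theorem continuous_edgeWeight (k : Fin n) (u : Vertex n) :
    Continuous fun p => edgeWeight p k u :=
  continuous_finsetProd _ fun i _ => (continuous_signWeight (u i)).comp (continuous_apply i)

/-- The expected number of crossing edges in the directions of `K`, integrated along a segment of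
biases. -/
theorem intervalIntegral_sum_crossSet_le (v : EuclideanSpace ℝ (Fin n)) (t : ℝ)
    (K : Finset (Fin n)) {c : ℝ} (b w : Fin n → ℝ) (hw : ∀ k, ∃ r, 0 ≤ r ∧ w k = r * v k)
    (hK : ∀ k ∈ K, ∃ r, c ≤ r * |v k| ∧ w k = r * v k) {x y : ℝ} (hxy : x ≤ y)
    (hp : ∀ a ∈ Set.Icc x y, ‖b + a • w‖ ≤ 1) :
    ∫ a in x..y, c * ∑ k ∈ K, ∑ u ∈ crossSet v t k, vertexWeight (b + a • w) u ≤ 4 := by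
  have hline : Continuous fun a : ℝ => b + a • w := by fun_prop
  have hcW : ∀ u : Vertex n, Continuous fun a : ℝ => vertexWeight (b + a • w) u := fun u =>
    (continuous_vertexWeight u).comp hline
  have hcE : ∀ (k : Fin n) (u : Vertex n), Continuous fun a : ℝ => edgeWeight (b + a • w) k u :=
    fun k u => (continuous_edgeWeight k u).comp hline
  let D : ℝ → ℝ := fun a =>
    ∑ k, w k / 2 * ∑ u, ((u k : ℤ) : ℝ) * edgeWeight (b + a • w) k u * halfSpace v t u
  have hD : Continuous D := by
    refine continuous_finsetSum _ fun k _ => continuous_const.mul ?_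
    exact continuous_finsetSum _ fun u _ => (continuous_const.mul (hcE k u)).mul continuous_const
  have hint : ∫ a in x..y, D a ≤ 1 := by
    rw [intervalIntegral.integral_eq_sub_of_hasDerivAt
      (fun a _ => hasDerivAt_sum_vertexWeight b w (halfSpace v t) a)
      (hD.intervalIntegrable _ _)]
    have h1 : ∑ u, vertexWeight (b + y • w) u * halfSpace v t u ≤ 1 := by
      rw [← sum_vertexWeight (b + y • w)]
      exact Finset.sum_le_sum fun u _ => mul_le_of_le_one_right
        (vertexWeight_nonneg (hp y (Set.right_mem_Icc.2 hxy)) u) (halfSpace_le_one v t u)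
    have h2 : 0 ≤ ∑ u, vertexWeight (b + x • w) u * halfSpace v t u :=
      Finset.sum_nonneg fun u _ => mul_nonneg
        (vertexWeight_nonneg (hp x (Set.left_mem_Icc.2 hxy)) u) (halfSpace_nonneg v t u)
    linarith
  have hle : ∀ a ∈ Set.Icc x y,
      c * ∑ k ∈ K, ∑ u ∈ crossSet v t k, vertexWeight (b + a • w) u ≤ 4 * D a := by
    intro a ha
    have hpa := hp a ha
    simp only [D]
    rw [Finset.mul_sum, Finset.mul_sum]
    have hterm : ∀ k, ∀ r, 0 ≤ r → w k = r * v k →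
        r * (|v k| * ∑ u ∈ crossSet v t k, vertexWeight (b + a • w) u) ≤
        4 * (w k / 2 * ∑ u, ((u k : ℤ) : ℝ) * edgeWeight (b + a • w) k u * halfSpace v t u) := by
      intro k r hr hwk
      have := mul_le_mul_of_nonneg_left (abs_mul_sum_crossSet_le hpa v t k) hr
      refine this.trans_eq ?_
      rw [hwk]; ring
    have hS : ∀ k, 0 ≤ ∑ u ∈ crossSet v t k, vertexWeight (b + a • w) u := fun k =>
      Finset.sum_nonneg fun u _ => vertexWeight_nonneg hpa u
    calc ∑ k ∈ K, c * ∑ u ∈ crossSet v t k, vertexWeight (b + a • w) u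
        ≤ ∑ k ∈ K, 4 * (w k / 2 *
          ∑ u, ((u k : ℤ) : ℝ) * edgeWeight (b + a • w) k u * halfSpace v t u) := by
          refine Finset.sum_le_sum fun k hk => ?_
          obtain ⟨r, hr, hwk⟩ := hK k hk
          obtain ⟨r', hr', hwk'⟩ := hw k
          refine le_trans ?_ (hterm k r' hr' hwk')
          rw [← mul_assoc]
          refine mul_le_mul_of_nonneg_right ?_ (hS k)
          -- Where `v k ≠ 0` the ratios supplied by `hw` and `hK` agree; where `v k = 0`, `hK`
          -- itself forces `c ≤ 0`.
          by_cases hv : v k = 0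
          · simpa [hv] using hr
          · have : r = r' := mul_right_cancel₀ hv (hwk.symm.trans hwk')
            exact this ▸ hr
      _ ≤ _ := by
          refine Finset.sum_le_sum_of_subset_of_nonneg (Finset.subset_univ _) fun k _ _ => ?_
          obtain ⟨r', hr', hwk'⟩ := hw k
          refine le_trans ?_ (hterm k r' hr' hwk')
          exact mul_nonneg hr' (mul_nonneg (abs_nonneg _) (hS k))
  have hcont : Continuous fun a : ℝ =>
      c * ∑ k ∈ K, ∑ u ∈ crossSet v t k, vertexWeight (b + a • w) u :=
    continuous_const.mul (continuous_finsetSum _ fun k _ => continuous_finsetSum _ fun u _ =>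
      hcW u)
  calc _ ≤ ∫ a in x..y, 4 * D a :=
        intervalIntegral.integral_mono_on hxy (hcont.intervalIntegrable _ _)
          ((continuous_const.mul hD).intervalIntegrable _ _) hle
    _ = 4 * ∫ a in x..y, D a := intervalIntegral.integral_const_mul _ _
    _ ≤ 4 := by linarith

/-- The total expected number of crossing edges in the directions of `K` along the part of a line
of biases on which the biases are at most `1 / 2`. -/
theorem setLIntegral_sum_vertexLaw_crossSet_le (v : EuclideanSpace ℝ (Fin n)) (t : ℝ)
    (K : Finset (Fin n)) {c : ℝ} (hc : 0 < c) (b w : Fin n → ℝ)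
    (hw : ∀ k, ∃ r, 0 ≤ r ∧ w k = r * v k)
    (hK : ∀ k ∈ K, ∃ r, c ≤ r * |v k| ∧ w k = r * v k) :
    ∫⁻ a in Set.Icc (-1 : ℝ) 1, ({a : ℝ | ‖b + a • w‖ ≤ 1 / 2}.indicator
      fun a => ∑ k ∈ K, vertexLaw (b + a • w) (crossSet v t k)) a ≤ ENNReal.ofReal (4 / c) := by
  have hline : Continuous fun a : ℝ => b + a • w := by fun_prop
  have hclosed : IsClosed {a : ℝ | ‖b + a • w‖ ≤ 1 / 2} :=
    isClosed_le hline.norm continuous_const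
  rw [lintegral_indicator hclosed.measurableSet, Measure.restrict_restrict hclosed.measurableSet]
  set T : Set ℝ := {a : ℝ | ‖b + a • w‖ ≤ 1 / 2} ∩ Set.Icc (-1) 1 with hT
  rcases T.eq_empty_or_nonempty with h0 | hne
  · rw [h0]; simp
  -- Norm balls are convex, so the admissible parameters form a compact interval and the fundamental
  -- theorem of calculus can be used on it.
  have hconv : Convex ℝ {a : ℝ | ‖b + a • w‖ ≤ 1 / 2} := by
    have h1 := (convex_closedBall (0 : Fin n → ℝ) (1 / 2)).affine_preimage
      (AffineMap.lineMap b (b + w) : ℝ →ᵃ[ℝ] (Fin n → ℝ))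
    have h2 : {a : ℝ | ‖b + a • w‖ ≤ 1 / 2} =
        (AffineMap.lineMap b (b + w) : ℝ →ᵃ[ℝ] (Fin n → ℝ)) ⁻¹' Metric.closedBall 0 (1 / 2) := by
      ext a
      simp [AffineMap.lineMap_apply, add_comm]
    exact h2 ▸ h1
  have hTc : IsConnected T := ⟨hne, (hconv.inter (convex_Icc _ _)).isPreconnected⟩
  have hTk : IsCompact T := isCompact_Icc.inter_left hclosed
  have hTI := eq_Icc_of_connected_compact hTc hTk
  have hxy : sInf T ≤ sSup T := by
    rw [hTI] at hne; exact Set.nonempty_Icc.1 hne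
  have hp : ∀ a ∈ T, ‖b + a • w‖ ≤ 1 := fun a ha => ha.1.trans (by norm_num)
  have hS : ∀ a ∈ T, 0 ≤ ∑ k ∈ K, ∑ u ∈ crossSet v t k, vertexWeight (b + a • w) u :=
    fun a ha => Finset.sum_nonneg fun k _ => Finset.sum_nonneg fun u _ =>
      vertexWeight_nonneg (hp a ha) u
  have hcont : Continuous fun a : ℝ =>
      ∑ k ∈ K, ∑ u ∈ crossSet v t k, vertexWeight (b + a • w) u :=
    continuous_finsetSum _ fun k _ => continuous_finsetSum _ fun u _ =>
      (continuous_vertexWeight u).comp hline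
  have e1 : ∫⁻ a in T, ∑ k ∈ K, vertexLaw (b + a • w) (crossSet v t k) =
      ∫⁻ a in T, ENNReal.ofReal
        (∑ k ∈ K, ∑ u ∈ crossSet v t k, vertexWeight (b + a • w) u) := by
    refine setLIntegral_congr_fun hTk.measurableSet fun a ha => ?_
    rw [ENNReal.ofReal_sum_of_nonneg]
    · exact Finset.sum_congr rfl fun k _ => vertexLaw_apply (hp a ha) _
    · exact fun k _ => Finset.sum_nonneg fun u _ => vertexWeight_nonneg (hp a ha) u
  rw [e1, ← ofReal_integral_eq_lintegral_ofReal]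
  · refine ENNReal.ofReal_le_ofReal ?_
    rw [le_div_iff₀' hc, ← integral_const_mul, hTI, integral_Icc_eq_integral_Ioc,
      ← intervalIntegral.integral_of_le hxy]
    exact intervalIntegral_sum_crossSet_le v t K b w hw hK hxy fun a ha => hp a (hTI ▸ ha)
  · exact hcont.continuousOn.integrableOn_compact hTk
  · exact (ae_restrict_iff' hTk.measurableSet).2 (Filter.Eventually.of_forall hS)

/-! ### Coordinates in lacunary bins -/

theorem exists_mem_binGroup {v : EuclideanSpace ℝ (Fin n)} {k : Fin n} (h : v k ≠ 0) :
    ∃ j, k ∈ binGroup v j := by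
  have hpos : 0 < |v k| := abs_pos.2 h
  refine ⟨-Int.clog 2 |v k|, ?_, ?_⟩
  · have := (Int.zpow_lt_iff_lt_clog (b := 2) (x := - -Int.clog 2 |v k| - 1) (by norm_num) hpos).2
      (by omega)
    exact_mod_cast this
  · have := (Int.le_zpow_iff_clog_le (b := 2) (x := - -Int.clog 2 |v k|) (by norm_num) hpos).2
      (by omega)
    exact_mod_cast this

theorem eq_of_mem_binGroup {v : EuclideanSpace ℝ (Fin n)} {k : Fin n} {i j : ℤ}
    (hi : k ∈ binGroup v i) (hj : k ∈ binGroup v j) : i = j := by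
  have h1 := (zpow_lt_zpow_iff_right₀ (by norm_num : (1 : ℝ) < 2)).1 (hi.1.trans_le hj.2)
  have h2 := (zpow_lt_zpow_iff_right₀ (by norm_num : (1 : ℝ) < 2)).1 (hj.1.trans_le hi.2)
  omega

theorem mem_binIndices {v : EuclideanSpace ℝ (Fin n)} {j : ℤ} :
    j ∈ binIndices v ↔ (binGroup v j).Nonempty := by
  simp [binIndices]

/-- The number of nonempty bins which precede the `j`-th one and whose index is congruent to `j`
modulo `3`. -/
def binRank (v : EuclideanSpace ℝ (Fin n)) (j : ℤ) : ℕ :=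
  {i ∈ binIndices v | i < j ∧ i % 3 = j % 3}.card

/-- Within one residue class modulo 3 the rank is strictly increasing, so the pair of residue and
rank determines the bin. -/
theorem card_filter_binRank_lt_le (v : EuclideanSpace ℝ (Fin n)) (R : ℕ) :
    {j ∈ binIndices v | binRank v j < R}.card ≤ 3 * R := by
  have hlt : ∀ i ∈ binIndices v, ∀ j, i < j → i % 3 = j % 3 → binRank v i < binRank v j := by
    intro i hi j hij hmod
    refine Finset.card_lt_card ((Finset.ssubset_iff_of_subset ?_).2 ⟨i, ?_, ?_⟩)
    · intro l hl
      simp only [Finset.mem_filter] at hl ⊢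
      exact ⟨hl.1, by omega, by omega⟩
    · simp [hi, hij, hmod]
    · simp
  have h : ({0, 1, 2} ×ˢ Finset.range R : Finset (ℤ × ℕ)).card = 3 * R := by
    rw [Finset.card_product, Finset.card_range]; rfl
  rw [← h]
  refine Finset.card_le_card_of_injOn (fun j => (j % 3, binRank v j)) ?_ ?_
  · intro j hj
    have := (Finset.mem_filter.1 hj).2
    simp only [Finset.coe_product, Set.mem_prod, Finset.mem_coe, Finset.mem_insert,
      Finset.mem_singleton, Finset.mem_range]
    exact ⟨by omega, this⟩
  · intro i hi j hj hij
    have hi' := (Finset.mem_filter.1 hi).1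
    have hj' := (Finset.mem_filter.1 hj).1
    obtain ⟨h1, h2⟩ := Prod.mk.inj hij
    rcases lt_trichotomy i j with h | h | h
    · exact absurd h2 (hlt i hi' j h h1).ne
    · exact h
    · exact absurd h2 (hlt j hj' i h h1.symm).ne'

theorem sum_two_zpow_neg_le (S : Finset ℤ) (a : ℤ) (hS : ∀ s ∈ S, a ≤ s ∧ s % 3 = a % 3) :
    ∑ s ∈ S, (2 : ℝ) ^ (-s) ≤ 2 ^ (-a) * (8 / 7) := by
  let φ : ℤ → ℕ := fun s => ((s - a) / 3).toNat
  have hφ : ∀ s ∈ S, s = a + 3 * (φ s : ℤ) := by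
    intro s hs
    have := hS s hs
    simp only [φ]
    omega
  have h1 : ∑ s ∈ S, (2 : ℝ) ^ (-s) = 2 ^ (-a) * ∑ s ∈ S, (1 / 8 : ℝ) ^ φ s := by
    rw [Finset.mul_sum]
    refine Finset.sum_congr rfl fun s hs => ?_
    conv_lhs => rw [hφ s hs]
    rw [neg_add, zpow_add₀ (by norm_num), ← mul_neg, zpow_mul, zpow_neg,
      zpow_neg, zpow_natCast, ← inv_pow]
    norm_num
  have hinj : Set.InjOn φ S := fun s hs s' hs' h => by
    rw [hφ s hs, hφ s' hs', h]
  rw [h1]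
  gcongr
  rw [← Finset.sum_image (f := fun i => (1 / 8 : ℝ) ^ i) hinj]
  have h2 := (summable_geometric_of_lt_one (r := (1 / 8 : ℝ)) (by norm_num)
    (by norm_num)).sum_le_tsum (S.image φ) fun i _ => by positivity
  refine h2.trans ?_
  rw [tsum_geometric_of_lt_one (by norm_num) (by norm_num)]
  norm_num

/-- Choose one coordinate from each bin counted by `binRank`. Two vertices of crossing edges that
agree elsewhere must coincide: at the coarsest chosen coordinate where they differ, the change in
`⟨v, u⟩` exceeds what the finer ones and the crossing window can compensate. -/
theorem sum_vertexWeight_crossSet_le {p : Fin n → ℝ} (hp : ‖p‖ ≤ 1 / 2)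
    (v : EuclideanSpace ℝ (Fin n)) (t : ℝ) {k : Fin n} {j : ℤ} (hk : k ∈ binGroup v j) :
    ∑ u ∈ crossSet v t k, vertexWeight p u ≤ (3 / 4) ^ binRank v j := by
  classical
  set F : Finset ℤ := {i ∈ binIndices v | i < j ∧ i % 3 = j % 3} with hF
  -- One representative per preceding bin; outside `F` the value `k` is only a filler.
  have hex : ∀ i : ℤ, ∃ l : Fin n, i ∈ F → l ∈ binGroup v i := by
    intro i
    by_cases hi : i ∈ F
    · obtain ⟨l, hl⟩ := mem_binIndices.1 (Finset.mem_filter.1 hi).1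
      exact ⟨l, fun _ => hl⟩
    · exact ⟨k, fun h => absurd h hi⟩
  choose e he using hex
  have hinj : Set.InjOn e F := fun i hi i' hi' h =>
    eq_of_mem_binGroup (he i hi) (h ▸ he i' hi')
  have hcard : (F.image e).card = binRank v j := Finset.card_image_of_injOn hinj
  rw [← hcard]
  refine sum_vertexWeight_le_pow hp _ _ fun u hu u' hu' hag => ?_
  by_contra hne
  have hu1 := (mem_crossSet.1 hu).abs_sub_lt
  have hu2 := (mem_crossSet.1 hu').abs_sub_lt
  set d : Fin n → ℝ := fun l => (((u l : ℤ) : ℝ) - ((u' l : ℤ) : ℝ)) * v l with hd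
  have hD : |∑ l, d l| < 4 * 2 ^ (-j) := by
    have e1 : ∑ l, d l = (inner ℝ v u.toPoint - t) - (inner ℝ v u'.toPoint - t) := by
      rw [inner_toPoint, inner_toPoint, sub_sub_sub_cancel_right, ← Finset.sum_sub_distrib]
      exact Finset.sum_congr rfl fun l _ => sub_mul _ _ _
    rw [e1]
    have := abs_sub (inner ℝ v u.toPoint - t) (inner ℝ v u'.toPoint - t)
    have := hk.2
    linarith
  have hdF : ∑ l, d l = ∑ i ∈ F, d (e i) := by
    rw [← Finset.sum_image hinj]
    refine (Finset.sum_subset (Finset.subset_univ _) fun l _ hl => ?_).symm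
    simp [hd, hag l hl]
  set F' : Finset ℤ := {i ∈ F | u (e i) ≠ u' (e i)} with hF'
  have hdF' : ∑ i ∈ F, d (e i) = ∑ i ∈ F', d (e i) := by
    refine (Finset.sum_subset (Finset.filter_subset _ _) fun i hi hi' => ?_).symm
    have : u (e i) = u' (e i) := by
      by_contra hc
      exact hi' (Finset.mem_filter.2 ⟨hi, hc⟩)
    simp [hd, this]
  have hne' : F'.Nonempty := by
    obtain ⟨l, hl⟩ := Function.ne_iff.1 hne
    have hlI : l ∈ F.image e := by
      by_contra hc
      exact hl (hag l hc)
    obtain ⟨i, hi, rfl⟩ := Finset.mem_image.1 hlI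
    exact ⟨i, Finset.mem_filter.2 ⟨hi, hl⟩⟩
  have habs : ∀ i ∈ F', |d (e i)| = 2 * |v (e i)| := by
    intro i hi
    have h1 := (Finset.mem_filter.1 hi).2
    rw [hd, abs_mul]
    congr 1
    rcases Int.units_eq_one_or (u (e i)) with h | h <;>
      rcases Int.units_eq_one_or (u' (e i)) with h' | h' <;> rw [h, h'] at h1 ⊢ <;>
      first | exact absurd rfl h1 | norm_num
  -- The coarsest differing scale. In units of `2^(-a)`, its term exceeds 1, the remaining terms
  -- total at most `2/8 * 8/7 = 2/7`, and the window contributes less than `4/8 = 1/2`. Since `2/7 +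
  -- 1/2 < 1`, this is a contradiction; it uses the spacing 3 of the bins.
  set a := F'.min' hne' with ha
  have haF' : a ∈ F' := F'.min'_mem hne'
  have haF := (Finset.mem_filter.1 haF').1
  have haj := (Finset.mem_filter.1 haF).2
  have hsplit := Finset.add_sum_erase F' (fun i => d (e i)) haF'
  have hrest : |∑ i ∈ F'.erase a, d (e i)| ≤ 2 * (2 ^ (-(a + 3)) * (8 / 7)) := by
    refine (Finset.abs_sum_le_sum_abs _ _).trans ?_
    have h1 : ∑ i ∈ F'.erase a, |d (e i)| ≤ ∑ i ∈ F'.erase a, 2 * (2 : ℝ) ^ (-i) := by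
      refine Finset.sum_le_sum fun i hi => ?_
      have hi' := Finset.mem_of_mem_erase hi
      rw [habs i hi']
      have := (he i (Finset.mem_filter.1 hi').1).2
      linarith
    refine h1.trans ?_
    rw [← Finset.mul_sum]
    refine mul_le_mul_of_nonneg_left (sum_two_zpow_neg_le _ _ fun i hi => ?_) (by norm_num)
    have hi' := Finset.mem_of_mem_erase hi
    have h2 := F'.min'_le i hi'
    have h3 := Finset.ne_of_mem_erase hi
    have h4 := (Finset.mem_filter.1 (Finset.mem_filter.1 hi').1).2
    omega
  have hmain : 2 * 2 ^ (-a - 1) < |d (e a)| := by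
    rw [habs a haF']
    have := (he a haF).1
    linarith
  have hj : (2 : ℝ) ^ (-j) ≤ 2 ^ (-(a + 3)) :=
    zpow_le_zpow_right₀ (by norm_num) (by omega)
  have e1 : (2 : ℝ) ^ (-(a + 3)) = 2 ^ (-a) / 8 := by
    rw [neg_add, zpow_add₀ (by norm_num)]; norm_num; ring
  have e2 : (2 : ℝ) ^ (-a - 1) = 2 ^ (-a) / 2 := by
    rw [zpow_sub₀ (by norm_num)]; norm_num
  have hpos : (0 : ℝ) < 2 ^ (-a) := by positivity
  have htri : |d (e a)| ≤ |∑ l, d l| + |∑ i ∈ F'.erase a, d (e i)| := by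
    rw [hdF, hdF', ← hsplit]
    have := abs_sub (d (e a) + ∑ i ∈ F'.erase a, d (e i)) (∑ i ∈ F'.erase a, d (e i))
    rwa [add_sub_cancel_right] at this
  rw [e1] at hj hrest
  rw [e2] at hmain
  linarith

variable {m : ℕ}

/-! ### The random bias as a function of the coefficients -/

/-- The normalizing factor of the random bias. -/
def biasScale (n m : ℕ) : ℝ := 1 / (10 * Real.sqrt (m * Real.log n))

/-- The direction in which a coefficient moves the random bias. -/
def biasDirection (v : Fin m → EuclideanSpace ℝ (Fin n)) (i : CoeffIndex v) : Fin n → ℝ :=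
  (biasScale n m * (2 : ℝ) ^ (i.2 : ℤ)) • binPart (v i.1) i.2

theorem randomBias_eq_sum (v : Fin m → EuclideanSpace ℝ (Fin n)) (α : CoeffIndex v → ℝ) :
    randomBias v α = ∑ i, α i • biasDirection v i := by
  rw [randomBias, Fintype.sum_sigma, Finset.smul_sum]
  refine Finset.sum_congr rfl fun ℓ _ => ?_
  rw [Finset.smul_sum]
  refine Finset.sum_congr rfl fun j _ => ?_
  rw [biasDirection, smul_smul, smul_smul, biasScale]
  congr 1
  ring

theorem randomBias_update (v : Fin m → EuclideanSpace ℝ (Fin n)) (α : CoeffIndex v → ℝ)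
    (i : CoeffIndex v) (a : ℝ) :
    randomBias v (Function.update α i a) =
      randomBias v (Function.update α i 0) + a • biasDirection v i := by
  rw [randomBias_eq_sum, randomBias_eq_sum, ← Finset.sum_erase_add _ _ (Finset.mem_univ i),
    ← Finset.sum_erase_add (a := i) Finset.univ (fun l => Function.update α i 0 l • _)
      (Finset.mem_univ i)]
  simp only [Function.update_self, zero_smul, add_zero]
  congr 1
  refine Finset.sum_congr rfl fun l hl => ?_
  rw [Function.update_of_ne (Finset.ne_of_mem_erase hl),
    Function.update_of_ne (Finset.ne_of_mem_erase hl)]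

theorem continuous_randomBias (v : Fin m → EuclideanSpace ℝ (Fin n)) :
    Continuous (randomBias v) := by
  have : randomBias v = fun α => ∑ i, α i • biasDirection v i :=
    funext (randomBias_eq_sum v)
  rw [this]
  fun_prop

/-- The uniform law on `[-1, 1]`. -/
abbrev uniformLaw : Measure ℝ := (volume : Measure ℝ)[|Set.Icc (-1) 1]

instance isProbabilityMeasure_uniformLaw : IsProbabilityMeasure uniformLaw :=
  cond_isProbabilityMeasure_of_finite (by simp) (by simp)

instance isProbabilityMeasure_coeffLaw (v : Fin m → EuclideanSpace ℝ (Fin n)) :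
    IsProbabilityMeasure (coeffLaw v) := by
  unfold coeffLaw; infer_instance

/-- The density is `1/2`; dropping it costs a constant factor and leaves plain Lebesgue integrals.
-/
theorem uniformLaw_le : uniformLaw ≤ volume.restrict (Set.Icc (-1) 1) := by
  refine Measure.le_iff.2 fun s _ => ?_
  rw [uniformLaw, ProbabilityTheory.cond, Measure.smul_apply, smul_eq_mul, Real.volume_Icc]
  refine mul_le_of_le_one_left zero_le ?_
  rw [ENNReal.inv_le_one]
  norm_num

/-- A bound for the integral over one coordinate bounds the integral over a product of
probability measures. -/
theorem lintegral_pi_le_of_update {ι : Type*} [Fintype ι] [DecidableEq ι] {X : ι → Type*}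
    [∀ i, MeasurableSpace (X i)] {μ : ∀ i, Measure (X i)} [∀ i, IsProbabilityMeasure (μ i)]
    {f : (∀ i, X i) → ENNReal} (hf : Measurable f) (i : ι) (B : ENNReal)
    (h : ∀ x, ∫⁻ a, f (Function.update x i a) ∂μ i ≤ B) :
    ∫⁻ x, f x ∂Measure.pi μ ≤ B := by
  have hne : Nonempty (∀ i, X i) := nonempty_of_isProbabilityMeasure (Measure.pi μ)
  obtain ⟨x⟩ := hne
  rw [lintegral_eq_lmarginal_univ x, lmarginal_erase' f hf (Finset.mem_univ i)]
  refine (lmarginal_mono (g := fun _ => B) h x).trans ?_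
  simp [lmarginal]

theorem measurable_vertexLaw_apply (A : Set (Vertex n)) :
    Measurable fun p : Fin n → ℝ => vertexLaw p A :=
  (Measure.measurable_coe (MeasurableSet.of_discrete)).comp (measurable_vertexLaw n)

theorem measurableSet_norm_randomBias_le (v : Fin m → EuclideanSpace ℝ (Fin n)) :
    MeasurableSet {α | ‖randomBias v α‖ ≤ 1 / 2} :=
  (isClosed_le (continuous_randomBias v).norm continuous_const).measurableSet

open Classical in
/-- The expected number of crossing edges in the directions of one bin. -/
theorem sum_setLIntegral_vertexLaw_crossSet_le (v : Fin m → EuclideanSpace ℝ (Fin n)) (t : ℝ)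
    (hs : 0 < biasScale n m) (i : CoeffIndex v) :
    ∑ k with k ∈ binGroup (v i.1) i.2, ∫⁻ α in {α | ‖randomBias v α‖ ≤ 1 / 2},
      vertexLaw (randomBias v α) (crossSet (v i.1) t k) ∂coeffLaw v ≤
        ENNReal.ofReal (8 / biasScale n m) := by
  have hmeas : ∀ k, Measurable fun α => vertexLaw (randomBias v α) (crossSet (v i.1) t k) :=
    fun k => (measurable_vertexLaw_apply _).comp (continuous_randomBias v).measurable
  rw [← lintegral_finsetSum _ fun k _ => hmeas k,
    ← lintegral_indicator (measurableSet_norm_randomBias_le v), coeffLaw]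
  refine lintegral_pi_le_of_update ?_ i _ fun α => ?_
  · exact (Finset.measurable_sum _ fun k _ => hmeas k).indicator
      (measurableSet_norm_randomBias_le v)
  · refine (lintegral_mono' uniformLaw_le le_rfl).trans ?_
    have hdir : ∀ k, k ∈ binGroup (v i.1) i.2 →
        biasDirection v i k = (biasScale n m * (2 : ℝ) ^ (i.2 : ℤ)) * v i.1 k := by
      intro k hk
      simp [biasDirection, binPart, hk]
    -- On the bin `|v k| > 2^(-j-1)`, so each entry of the direction has size at least `biasScale n
    -- m / 2`, which serves as `c`.
    have h8 : 8 / biasScale n m = 4 / (biasScale n m / 2) := by field_simp; norm_num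
    rw [h8]
    refine le_trans (le_of_eq ?_) (setLIntegral_sum_vertexLaw_crossSet_le (v i.1) t
      {k | k ∈ binGroup (v i.1) i.2} (half_pos hs)
      (randomBias v (Function.update α i 0)) (biasDirection v i) ?_ ?_)
    · refine lintegral_congr fun a => ?_
      simp only [Set.indicator, Set.mem_ofPred_eq, randomBias_update v α i a]
    · intro k
      by_cases hk : k ∈ binGroup (v i.1) i.2
      · exact ⟨_, by positivity, hdir k hk⟩
      · exact ⟨0, le_rfl, by simp [biasDirection, binPart, hk]⟩
    · intro k hk
      have hk' : k ∈ binGroup (v i.1) i.2 := by simpa using hk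
      refine ⟨_, ?_, hdir k hk'⟩
      have h1 := hk'.1.le
      rw [zpow_sub₀ (by norm_num), zpow_neg, zpow_one] at h1
      have hp : (0 : ℝ) < 2 ^ (i.2 : ℤ) := by positivity
      calc biasScale n m / 2
          = biasScale n m * 2 ^ (i.2 : ℤ) * (((2 : ℝ) ^ (i.2 : ℤ))⁻¹ / 2) := by field_simp
        _ ≤ _ := by gcongr

/-! ### The random bias is small with probability at least one half -/

theorem integral_uniformLaw_id : ∫ x, x ∂uniformLaw = 0 := by
  rw [uniformLaw, ProbabilityTheory.cond, integral_smul_measure, integral_Icc_eq_integral_Ioc,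
    ← intervalIntegral.integral_of_le (by norm_num), integral_id]
  norm_num

theorem hasSubgaussianMGF_uniformLaw : HasSubgaussianMGF (fun x : ℝ => x) 1 uniformLaw := by
  have h := hasSubgaussianMGF_of_mem_Icc_of_integral_eq_zero (X := fun x : ℝ => x)
    (μ := uniformLaw) (a := -1) (b := 1) aemeasurable_id
    (ae_cond_mem measurableSet_Icc) integral_uniformLaw_id
  convert h
  have : (1 : ℝ) - -1 = 2 := by norm_num
  rw [this]
  simp

theorem hasSubgaussianMGF_sum_mul_coeffLaw (v : Fin m → EuclideanSpace ℝ (Fin n))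
    (w : CoeffIndex v → ℝ) {C : NNReal} (hC : ∑ i, w i ^ 2 ≤ C) :
    HasSubgaussianMGF (fun α : CoeffIndex v → ℝ => ∑ i, w i * α i) C (coeffLaw v) := by
  have hind : iIndepFun (fun (i : CoeffIndex v) (α : CoeffIndex v → ℝ) => w i * α i)
      (coeffLaw v) :=
    iIndepFun_pi (X := fun i (x : ℝ) => w i * x)
      fun i => (measurable_const_mul (w i)).aemeasurable
  have hsub : ∀ i, HasSubgaussianMGF (fun α : CoeffIndex v → ℝ => w i * α i)
      (⟨w i ^ 2, sq_nonneg _⟩ * 1) (coeffLaw v) := by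
    intro i
    refine HasSubgaussianMGF.const_mul (X := fun α : CoeffIndex v → ℝ => α i) ?_ (w i)
    refine HasSubgaussianMGF.of_map (X := fun x : ℝ => x)
      (Y := fun α : CoeffIndex v → ℝ => α i)
      (measurable_pi_apply i).aemeasurable ?_
    have := (measurePreserving_eval (fun _ : CoeffIndex v => uniformLaw) i).map_eq
    exact this.symm ▸ hasSubgaussianMGF_uniformLaw
  have h := HasSubgaussianMGF.sum_of_iIndepFun hind (s := Finset.univ) fun i _ => hsub i
  refine ⟨h.integrable_exp_mul, fun s => (h.mgf_le s).trans ?_⟩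
  gcongr
  rw [← NNReal.coe_le_coe, NNReal.coe_sum]
  exact (Finset.sum_congr rfl fun i _ => mul_one (w i ^ 2)).trans_le hC

/-- A coordinate lies in at most one bin, and there `2^j * |x k| ≤ 1`. -/
theorem sum_sq_binPart_le (x : EuclideanSpace ℝ (Fin n)) (k : Fin n) :
    ∑ j : ↥(binIndices x), ((2 : ℝ) ^ (j : ℤ) * binPart x j k) ^ 2 ≤ 1 := by
  by_cases h : ∃ j : ↥(binIndices x), k ∈ binGroup x j
  · obtain ⟨j, hj⟩ := h
    rw [Fintype.sum_eq_single j]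
    · have h1 := hj.2
      have hp : (0 : ℝ) < 2 ^ (j : ℤ) := by positivity
      rw [sq_le_one_iff_abs_le_one, binPart, Set.indicator_of_mem hj, abs_mul, abs_of_pos hp]
      calc (2 : ℝ) ^ (j : ℤ) * |x k| ≤ 2 ^ (j : ℤ) * 2 ^ (-(j : ℤ)) := by gcongr
        _ = 1 := by rw [zpow_neg, mul_inv_cancel₀ hp.ne']
    · intro l hl
      have : k ∉ binGroup x l := fun hk => hl (Subtype.ext (eq_of_mem_binGroup hk hj))
      simp [binPart, this]
  · push Not at h
    rw [Finset.sum_eq_zero]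
    · norm_num
    · intro j _
      simp [binPart, h j]

theorem sum_sq_biasDirection_le (hn : 2 ≤ n) (v : Fin m → EuclideanSpace ℝ (Fin n)) (k : Fin n) :
    ∑ i, biasDirection v i k ^ 2 ≤ 1 / (100 * Real.log n) := by
  have hlog : 0 < Real.log n := Real.log_pos (by exact_mod_cast hn)
  have h1 : ∑ i, biasDirection v i k ^ 2 ≤ m * biasScale n m ^ 2 := by
    rw [Fintype.sum_sigma]
    calc _ ≤ ∑ _ℓ : Fin m, biasScale n m ^ 2 := by
          refine Finset.sum_le_sum fun ℓ _ => ?_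
          calc _ = biasScale n m ^ 2 *
                ∑ j : ↥(binIndices (v ℓ)), ((2 : ℝ) ^ (j : ℤ) * binPart (v ℓ) j k) ^ 2 := by
                rw [Finset.mul_sum]
                refine Finset.sum_congr rfl fun j _ => ?_
                simp only [biasDirection, Pi.smul_apply, smul_eq_mul]
                ring
            _ ≤ _ := mul_le_of_le_one_right (sq_nonneg _) (sum_sq_binPart_le (v ℓ) k)
      _ = _ := by simp
  refine h1.trans ?_
  rcases Nat.eq_zero_or_pos m with rfl | hm
  · simp; positivity
  · have hm' : (0 : ℝ) < m := by exact_mod_cast hm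
    rw [biasScale, div_pow, mul_pow, Real.sq_sqrt (by positivity)]
    refine le_of_eq ?_
    field_simp
    norm_num

theorem measureReal_half_le_abs_randomBias_le (hn : 2 ≤ n)
    (v : Fin m → EuclideanSpace ℝ (Fin n)) (k : Fin n) :
    (coeffLaw v).real {α | 1 / 2 ≤ |randomBias v α k|} ≤ 2 / (n : ℝ) ^ 3 := by
  have hlog : 0 < Real.log n := Real.log_pos (by exact_mod_cast hn)
  have hn0 : (0 : ℝ) < n := by positivity
  let C : NNReal := ⟨1 / (100 * Real.log n), by positivity⟩
  have hC : (C : ℝ) = 1 / (100 * Real.log n) := rfl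
  -- The tail exponent is `(1/2)² * 100 log n / 2 = (25/2) log n ≥ 3 log n`. With the cube, the
  -- union bound over `n` coordinates and two signs gives `2 / n² ≤ 1/2`, already for `n = 2`.
  have hexp : Real.exp (-(1 / 2) ^ 2 / (2 * C)) ≤ 1 / (n : ℝ) ^ 3 := by
    have : 1 / (n : ℝ) ^ 3 = Real.exp (-(3 * Real.log n)) := by
      rw [Real.exp_neg, ← Real.log_rpow hn0, Real.exp_log (by positivity)]
      rw [Real.rpow_ofNat, one_div]
    rw [this, Real.exp_le_exp, hC]
    have e : -(1 / 2) ^ 2 / (2 * (1 / (100 * Real.log n))) = -(25 / 2 * Real.log n) := by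
      field_simp; norm_num
    rw [e]
    linarith
  have hkey : ∀ w : CoeffIndex v → ℝ, ∑ i, w i ^ 2 ≤ C →
      (coeffLaw v).real {α | 1 / 2 ≤ ∑ i, w i * α i} ≤ 1 / (n : ℝ) ^ 3 := fun w hw =>
    ((hasSubgaussianMGF_sum_mul_coeffLaw v w hw).measure_ge_le (by norm_num)).trans hexp
  have h1 := hkey (fun i => biasDirection v i k) (sum_sq_biasDirection_le hn v k)
  have h2 := hkey (fun i => -biasDirection v i k)
    (by simp only [neg_sq]; exact sum_sq_biasDirection_le hn v k)
  have hP : ∀ α, randomBias v α k = ∑ i, biasDirection v i k * α i := by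
    intro α
    rw [randomBias_eq_sum, Finset.sum_apply]
    exact Finset.sum_congr rfl fun i _ => by simp [mul_comm]
  have hsub : {α | 1 / 2 ≤ |randomBias v α k|} ⊆
      {α | 1 / 2 ≤ ∑ i, biasDirection v i k * α i} ∪
        {α | 1 / 2 ≤ ∑ i, -biasDirection v i k * α i} := by
    intro α hα
    rcases le_abs.1 (show 1 / 2 ≤ |randomBias v α k| from hα) with h | h
    · left
      rwa [hP] at h
    · right
      rw [hP, ← Finset.sum_neg_distrib] at h
      simp only [← neg_mul] at h
      exact h
  calc _ ≤ _ := measureReal_mono hsub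
    _ ≤ _ := measureReal_union_le _ _
    _ ≤ 1 / (n : ℝ) ^ 3 + 1 / (n : ℝ) ^ 3 := add_le_add h1 h2
    _ = _ := by ring

theorem half_le_coeffLaw_norm_randomBias_le (hn : 2 ≤ n)
    (v : Fin m → EuclideanSpace ℝ (Fin n)) :
    2⁻¹ ≤ coeffLaw v {α | ‖randomBias v α‖ ≤ 1 / 2} := by
  have hn' : (2 : ℝ) ≤ n := by exact_mod_cast hn
  have hcompl : (coeffLaw v).real {α | ‖randomBias v α‖ ≤ 1 / 2}ᶜ ≤ 1 / 2 := by
    have hsub : {α | ‖randomBias v α‖ ≤ 1 / 2}ᶜ ⊆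
        ⋃ k ∈ (Finset.univ : Finset (Fin n)), {α | 1 / 2 ≤ |randomBias v α k|} := by
      intro α hα
      by_contra hc
      refine hα ((pi_norm_le_iff_of_nonneg (by norm_num)).2 fun k => ?_)
      by_contra hk
      refine hc (Set.mem_biUnion (Finset.mem_univ k) ?_)
      exact (not_le.1 hk).le
    calc _ ≤ _ := measureReal_mono hsub (measure_ne_top _ _)
      _ ≤ ∑ k, (coeffLaw v).real {α | 1 / 2 ≤ |randomBias v α k|} :=
        measureReal_biUnion_finset_le _ _
      _ ≤ ∑ _k : Fin n, 2 / (n : ℝ) ^ 3 :=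
        Finset.sum_le_sum fun k _ => measureReal_half_le_abs_randomBias_le hn v k
      _ = 2 / (n : ℝ) ^ 2 := by
        have : (n : ℝ) ≠ 0 := by positivity
        simp; field_simp
      _ ≤ 2 / (2 : ℝ) ^ 2 := by gcongr
      _ = 1 / 2 := by norm_num
  have h := probReal_compl_eq_one_sub (μ := coeffLaw v) (measurableSet_norm_randomBias_le v)
  have h2 : 1 / 2 ≤ (coeffLaw v).real {α | ‖randomBias v α‖ ≤ 1 / 2} := by linarith
  have h3 := ENNReal.ofReal_le_ofReal h2
  rw [ofReal_measureReal] at h3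
  refine le_trans (le_of_eq ?_) h3
  rw [one_div, ENNReal.ofReal_inv_of_pos (by norm_num)]
  simp

/-! ### The law of the random edge -/

theorem measurableSet_norm_le : MeasurableSet {p : Fin n → ℝ | ‖p‖ ≤ 1 / 2} :=
  (isClosed_le continuous_norm continuous_const).measurableSet

theorem half_le_map_randomBias (hn : 2 ≤ n) (v : Fin m → EuclideanSpace ℝ (Fin n)) :
    2⁻¹ ≤ ((coeffLaw v).map (randomBias v)) {p | ‖p‖ ≤ 1 / 2} := by
  rw [Measure.map_apply (continuous_randomBias v).measurable measurableSet_norm_le]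
  exact half_le_coeffLaw_norm_randomBias_le hn v

theorem isProbabilityMeasure_biasLaw (hn : 2 ≤ n) (v : Fin m → EuclideanSpace ℝ (Fin n)) :
    IsProbabilityMeasure (biasLaw v) := by
  have : IsProbabilityMeasure ((coeffLaw v).map (randomBias v)) :=
    Measure.isProbabilityMeasure_map (continuous_randomBias v).aemeasurable
  refine cond_isProbabilityMeasure (ne_of_gt (lt_of_lt_of_le ?_ (half_le_map_randomBias hn v)))
  simp

theorem isProbabilityMeasure_bind_vertexKernel (hn : 2 ≤ n)
    (v : Fin m → EuclideanSpace ℝ (Fin n)) :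
    IsProbabilityMeasure ((biasLaw v).bind (vertexKernel n)) := by
  have := isProbabilityMeasure_biasLaw hn v
  constructor
  rw [Measure.bind_apply MeasurableSet.univ (vertexKernel n).measurable.aemeasurable]
  -- `vertexLaw p` is known to have mass 1 only for `‖p‖ ≤ 1`, so the conditioning is needed here.
  have h : ∀ᵐ p ∂biasLaw v, vertexKernel n p Set.univ = 1 := by
    filter_upwards [ae_cond_mem measurableSet_norm_le] with p hp
    have := isProbabilityMeasure_vertexLaw (p := p)
      ((show ‖p‖ ≤ 1 / 2 from hp).trans (by norm_num))
    exact measure_univ (μ := vertexLaw p)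
  rw [lintegral_congr_ae h]
  simp

theorem isProbabilityMeasure_edgeLaw (hn : 2 ≤ n) (v : Fin m → EuclideanSpace ℝ (Fin n)) :
    IsProbabilityMeasure (edgeLaw v) := by
  have := isProbabilityMeasure_bind_vertexKernel hn v
  have : Nonempty (Fin n) := ⟨⟨0, by omega⟩⟩
  have : IsProbabilityMeasure (uniformOn (Set.univ : Set (Fin n))) :=
    isProbabilityMeasure_uniformOn Set.finite_univ Set.univ_nonempty
  unfold edgeLaw
  infer_instance

/-- The conditioning event has probability at least `1/2`, so normalizing multiplies by at most 2.
-/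
theorem bind_vertexKernel_apply_le (hn : 2 ≤ n) (v : Fin m → EuclideanSpace ℝ (Fin n))
    (A : Set (Vertex n)) :
    (biasLaw v).bind (vertexKernel n) A ≤
      2 * ∫⁻ α in {α | ‖randomBias v α‖ ≤ 1 / 2}, vertexLaw (randomBias v α) A ∂coeffLaw v := by
  rw [Measure.bind_apply MeasurableSet.of_discrete (vertexKernel n).measurable.aemeasurable, biasLaw,
    ProbabilityTheory.cond, lintegral_smul_measure, smul_eq_mul]
  change _ * ∫⁻ p in _, vertexLaw p A ∂_ ≤ _
  rw [setLIntegral_map measurableSet_norm_le (measurable_vertexLaw_apply A)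
    (continuous_randomBias v).measurable]
  refine mul_le_mul' ?_ le_rfl
  rw [ENNReal.inv_le_iff_inv_le]
  exact half_le_map_randomBias hn v

theorem edgeLaw_apply (hn : 2 ≤ n) (v : Fin m → EuclideanSpace ℝ (Fin n))
    (S : Set (Vertex n × Fin n)) :
    edgeLaw v S =
      (n : ENNReal)⁻¹ * ∑ k, (biasLaw v).bind (vertexKernel n) {u | (u, k) ∈ S} := by
  have := isProbabilityMeasure_bind_vertexKernel hn v
  rw [edgeLaw, Measure.prod_apply_symm MeasurableSet.of_discrete, uniformOn,
    ProbabilityTheory.cond, lintegral_smul_measure, Measure.restrict_univ, lintegral_count,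
    tsum_fintype, smul_eq_mul, Measure.count_univ]
  simp [Set.preimage]

/-- The expected number of crossing edges on the event that the random bias is small. -/
theorem sum_setLIntegral_crossSet_le (v : Fin m → EuclideanSpace ℝ (Fin n)) (t : ℝ)
    (hs : 0 < biasScale n m) (ℓ : Fin m) (R : ℕ) :
    ∑ k, ∫⁻ α in {α | ‖randomBias v α‖ ≤ 1 / 2},
      vertexLaw (randomBias v α) (crossSet (v ℓ) t k) ∂coeffLaw v ≤
        ENNReal.ofReal (3 * R * (8 / biasScale n m) + n * (3 / 4) ^ R) := by
  classical
  set E : Fin n → ENNReal := fun k => ∫⁻ α in {α | ‖randomBias v α‖ ≤ 1 / 2},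
      vertexLaw (randomBias v α) (crossSet (v ℓ) t k) ∂coeffLaw v
  set J : Finset ℤ := {j ∈ binIndices (v ℓ) | binRank (v ℓ) j < R}
  -- A direction outside the low-rank bins either has `v ℓ k = 0`, and then no edge crosses, or lies
  -- in a bin of rank at least `R`.
  have hsmall : ∀ k, (∀ j ∈ J, k ∉ binGroup (v ℓ) j) → E k ≤ ENNReal.ofReal ((3 / 4) ^ R) := by
    intro k hk
    by_cases h0 : v ℓ k = 0
    · have : crossSet (v ℓ) t k = ∅ :=
        Finset.eq_empty_of_forall_notMem fun u hu => (mem_crossSet.1 hu).ne_zero h0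
      simp [E, this]
    · obtain ⟨j, hj⟩ := exists_mem_binGroup h0
      have hR : R ≤ binRank (v ℓ) j := by
        by_contra hc
        exact hk j (Finset.mem_filter.2 ⟨mem_binIndices.2 ⟨k, hj⟩, not_le.1 hc⟩) hj
      calc E k ≤ ∫⁻ _α in {α | ‖randomBias v α‖ ≤ 1 / 2},
            ENNReal.ofReal ((3 / 4) ^ R) ∂coeffLaw v := by
            refine setLIntegral_mono measurable_const fun α hα => ?_
            have hα' : ‖randomBias v α‖ ≤ 1 / 2 := hα
            rw [vertexLaw_apply (hα'.trans (by norm_num))]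
            refine ENNReal.ofReal_le_ofReal
              ((sum_vertexWeight_crossSet_le hα' (v ℓ) t hj).trans ?_)
            exact pow_le_pow_of_le_one (by norm_num) (by norm_num) hR
        _ ≤ _ := by
            rw [setLIntegral_const]
            exact mul_le_of_le_one_right zero_le prob_le_one
  have hbin : ∀ j ∈ J, ∑ k with k ∈ binGroup (v ℓ) j, E k ≤
      ENNReal.ofReal (8 / biasScale n m) := fun j hj =>
    sum_setLIntegral_vertexLaw_crossSet_le v t hs ⟨ℓ, ⟨j, (Finset.mem_filter.1 hj).1⟩⟩
  have hpoint : ∀ k, E k ≤ (∑ j ∈ J, if k ∈ binGroup (v ℓ) j then E k else 0) +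
      ENNReal.ofReal ((3 / 4) ^ R) := by
    intro k
    by_cases h : ∃ j ∈ J, k ∈ binGroup (v ℓ) j
    · obtain ⟨j, hj, hk⟩ := h
      refine le_trans ?_ le_self_add
      have := Finset.single_le_sum (f := fun j => if k ∈ binGroup (v ℓ) j then E k else 0)
        (fun _ _ => zero_le) hj
      simpa [hk] using this
    · push Not at h
      exact (hsmall k h).trans le_add_self
  have h8 : 0 ≤ 8 / biasScale n m := by positivity
  calc ∑ k, E k ≤ ∑ k, ((∑ j ∈ J, if k ∈ binGroup (v ℓ) j then E k else 0) +
        ENNReal.ofReal ((3 / 4) ^ R)) := Finset.sum_le_sum fun k _ => hpoint k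
    _ = ∑ j ∈ J, ∑ k with k ∈ binGroup (v ℓ) j, E k +
        n * ENNReal.ofReal ((3 / 4) ^ R) := by
        rw [Finset.sum_add_distrib, Finset.sum_comm]
        simp [Finset.sum_filter]
    _ ≤ ∑ _j ∈ J, ENNReal.ofReal (8 / biasScale n m) + n * ENNReal.ofReal ((3 / 4) ^ R) := by
        gcongr with j hj
        exact hbin j hj
    _ = J.card * ENNReal.ofReal (8 / biasScale n m) + n * ENNReal.ofReal ((3 / 4) ^ R) := by
        simp
    _ ≤ ((3 * R : ℕ) : ENNReal) * ENNReal.ofReal (8 / biasScale n m) +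
        n * ENNReal.ofReal ((3 / 4) ^ R) := by
        gcongr
        exact card_filter_binRank_lt_le (v ℓ) R
    _ = _ := by
        rw [ENNReal.ofReal_add (by positivity) (by positivity),
          ENNReal.ofReal_mul (p := 3 * (R : ℝ)) (by positivity),
          ENNReal.ofReal_mul (p := (n : ℝ)) (by positivity),
          ← ENNReal.ofReal_natCast, ← ENNReal.ofReal_natCast]
        push_cast
        rfl

theorem edgeLaw_real_crosses_le (hn : 2 ≤ n) (v : Fin m → EuclideanSpace ℝ (Fin n)) (t : ℝ)
    (hs : 0 < biasScale n m) (ℓ : Fin m) (R : ℕ) :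
    (edgeLaw v).real {e | Crosses e.1 e.2 (hyperplane (v ℓ) t)} ≤
      2 * (3 * R * (8 / biasScale n m) + n * (3 / 4) ^ R) / n := by
  have hn0 : (0 : ℝ) < n := by positivity
  have h8 : 0 ≤ 8 / biasScale n m := by positivity
  refine ENNReal.toReal_le_of_le_ofReal (by positivity) ?_
  rw [edgeLaw_apply hn]
  calc _ ≤ (n : ENNReal)⁻¹ * ∑ k, 2 * ∫⁻ α in {α | ‖randomBias v α‖ ≤ 1 / 2},
        vertexLaw (randomBias v α) (crossSet (v ℓ) t k) ∂coeffLaw v := by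
        gcongr with k
        rw [coe_crossSet]
        exact bind_vertexKernel_apply_le hn v _
    _ ≤ (n : ENNReal)⁻¹ * (2 *
        ENNReal.ofReal (3 * R * (8 / biasScale n m) + n * (3 / 4) ^ R)) := by
        rw [← Finset.mul_sum]
        gcongr
        exact sum_setLIntegral_crossSet_le v t hs ℓ R
    _ = _ := by
        rw [ENNReal.ofReal_div_of_pos hn0, ENNReal.ofReal_mul (by norm_num), ENNReal.ofReal_natCast,
          ENNReal.div_eq_inv_mul]
        simp

theorem edgeLaw_real_crosses_le_sqrt_mul_log_sq (hn : 2 ≤ n)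
    (v : Fin m → EuclideanSpace ℝ (Fin n)) (t : ℝ) (ℓ : Fin m) :
    (edgeLaw v).real {e | Crosses e.1 e.2 (hyperplane (v ℓ) t)} ≤
      6000 * (Real.sqrt m * Real.log n ^ 2 / n) := by
  have hn2 : (2 : ℝ) ≤ n := by exact_mod_cast hn
  have hn0 : (0 : ℝ) < n := by linarith
  have hlog2 : 0.69 < Real.log n :=
    lt_of_lt_of_le (by linarith [Real.log_two_gt_d9]) (Real.log_le_log (by norm_num) hn2)
  have hm : (1 : ℝ) ≤ m := by exact_mod_cast (by have := ℓ.pos; omega : 1 ≤ m)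
  set L := Real.log n with hL
  have hL0 : 0 < L := by linarith
  have hs : 0 < biasScale n m := by
    unfold biasScale
    have : 0 < Real.sqrt (m * L) := Real.sqrt_pos.2 (by positivity)
    positivity
  -- Since `3/4 ≤ exp (-1/4)`, this choice gives `n * (3/4)^R ≤ 1`. The rounding is absorbed in `6 *
  -- L` because `2 * L > 1`.
  set R := ⌈4 * L⌉₊ with hR
  have hR1 : 4 * L ≤ R := Nat.le_ceil _
  have hR2 : (R : ℝ) ≤ 6 * L := by
    have := (Nat.ceil_lt_add_one (by positivity : 0 ≤ 4 * L)).le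
    linarith
  have hpow : (3 / 4 : ℝ) ^ R ≤ 1 / n := by
    have h1 : (3 / 4 : ℝ) ≤ Real.exp (-(1 / 4)) := by
      have := Real.add_one_le_exp (-(1 / 4) : ℝ)
      linarith
    calc (3 / 4 : ℝ) ^ R ≤ Real.exp (-(1 / 4)) ^ R := by gcongr
      _ = Real.exp (-(R / 4)) := by rw [← Real.exp_nat_mul]; congr 1; ring
      _ ≤ Real.exp (-L) := Real.exp_le_exp.2 (by linarith)
      _ = 1 / n := by rw [Real.exp_neg, hL, Real.exp_log hn0, one_div]
  have hscale : 8 / biasScale n m = 80 * (Real.sqrt m * Real.sqrt L) := by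
    rw [biasScale, ← hL, ← Real.sqrt_mul (by positivity)]
    field_simp
    norm_num
  have hsm : 1 ≤ Real.sqrt m := Real.one_le_sqrt.2 hm
  -- Here `log^(3/2)` is weakened to `log²`; `L > 0.69` justifies the factor `5/4`.
  have hsL : Real.sqrt L ≤ 5 / 4 * L := by
    rw [Real.sqrt_le_left (by positivity)]
    nlinarith
  refine (edgeLaw_real_crosses_le hn v t hs ℓ R).trans ?_
  rw [hscale, ← mul_div_assoc]
  refine div_le_div_of_nonneg_right ?_ hn0.le
  have hnp : (n : ℝ) * (3 / 4) ^ R ≤ 1 := by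
    calc (n : ℝ) * (3 / 4) ^ R ≤ n * (1 / n) := by gcongr
      _ = 1 := by field_simp
  have hA : 3 * (R : ℝ) * (80 * (Real.sqrt m * Real.sqrt L)) ≤
      3 * (6 * L) * (80 * (Real.sqrt m * (5 / 4 * L))) := by gcongr
  -- The high-rank contribution, at most 1, is absorbed as well. The total constant is `2 * (3 * 6 *
  -- 80 * 5/4 + 3) = 3606`, below 6000.
  have hB : 1 ≤ 3 * (Real.sqrt m * L ^ 2) := by nlinarith [sq_nonneg L]
  nlinarith

end CubeSlicing

end

theorem mainTheorem2 :
    ∃ C : ℝ, 0 < C ∧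
      ∀ (n m : ℕ), 2 ≤ n →
        ∀ (v : Fin m → EuclideanSpace ℝ (Fin n)) (t : Fin m → ℝ), (∀ ℓ, ‖v ℓ‖ = 1) →
          IsProbabilityMeasure (CubeSlicing.edgeLaw v) ∧
          ∀ ℓ : Fin m,
            (CubeSlicing.edgeLaw v).real
                {e | CubeSlicing.Crosses e.1 e.2 (CubeSlicing.hyperplane (v ℓ) (t ℓ))} ≤
              C * (Real.sqrt m * Real.log n ^ 2 / n) :=
  ⟨6000, by norm_num, fun _ _ hn v t _ => ⟨CubeSlicing.isProbabilityMeasure_edgeLaw hn v,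
    fun ℓ => CubeSlicing.edgeLaw_real_crosses_le_sqrt_mul_log_sq hn v (t ℓ) ℓ⟩⟩
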